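/- Let $\Gamma$ be a second countable, locally compact Hausdorff abelian group (for example $\mathbb Z^\mu$ or $\mathbb R^\mu$, $\mu\ge 1$). Call a subgroup $\Delta\subseteq\Gamma$ crystallographic if it is closed, not compact, and $\Gamma/\Delta$ is compact ($\Delta=\Gamma$ is allowed when $\Gamma$ is not compact; for $\Gamma=\mathbb Z^\mu$ these are the subgroups of finite index). Let $\mathcal A$ be a quasi-local $C^*$-system on $\Gamma$: a unital $C^*$-algebra with unital $C^*$-subalgebras $\mathcal A_S$ ($S\subseteq\Gamma$), increasing in $S$, such that $\bigcup_{S\text{ relatively compact}}\mathcal A_S$ is norm dense and elements of $\mathcal A_S$ and $\mathcal A_{S'}$ commute if $S\cap S'=\emptyset$, together with an action $\tau$ of $\Gamma$ on $\mathcal A$ by $*$-automorphisms with $\tau_x(\mathcal A_S)=\mathcal A_{S+x}$. Let $\{\alpha_t\}_{t\in\mathbb R}$ be a strongly continuous one-parameter group of $*$-automorphisms of $\mathcal A$ that is homogeneous in space: for some crystallographic subgroup $\Delta_0$ one has $\alpha_t\tau_x=\tau_x\alpha_t$ for all $t\in\mathbb R$, $x\in\Delta_0$. An equilibrium state is a state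 $\varphi$ on $\mathcal A$ that is either a $\beta$-KMS state for some $0<\beta<\infty$ (for all $A,B\in\mathcal A$ there is a bounded continuous function $F$ on $\{0\le\operatorname{Im}z\le\beta\}$, analytic in the interior, with $F(t)=\varphi(A\alpha_t(B))$ and $F(t+i\beta)=\varphi(\alpha_t(B)A)$ for all $t\in\mathbb R$) or a ground state (for all $A,B\in\mathcal A$ there is a bounded continuous function $F$ on $\{\operatorname{Im}z\ge0\}$, analytic in the interior, with $F(t)=\varphi(A\alpha_t(B))$ for all $t\in\mathbb R$). Let $\varphi$ be an equilibrium state that is invariant under $\tau_x$ for all $x$ in a crystallographic subgroup $\Delta$ (translation-invariant if $\Delta=\Gamma$, spatially periodic otherwise), and let $(\mathcal H_\varphi,\pi_\varphi,\Omega_\varphi)$ be its GNS representation. Assume that $x\mapsto\tau_x(A)$ is norm continuous on $\Delta$ for each $A\in\mathcal A$ (which is automatic if $\Delta$ is discrete). For $\Lambda\subseteq\Delta$ of finite volume put $m_\Lambda(A)=|\Lambda|^{-1}\int_\Lambda\tau_x(A)\,dx$ with respect to Haar measure of $\Delta$; if $\Delta$ is discrete this is $|\Lambda|^{-1}\sum_{x\in\Lambda}\tau_x(A)$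 over the finite set $\Lambda$. Write $\Lambda\uparrow\Delta$ for a net of measurable sets of finite volume that eventually contains every compact subset of $\Delta$. A macroscopic density $\widehat A_\infty$ of $A$ is the weak-operator limit of $\pi_\varphi(m_\Lambda(A))$ along such a net (equivalently, the densities are the weak-operator accumulation points of such nets), and $\widehat A_\infty(t)$ denotes the corresponding limit of $\pi_\varphi(m_\Lambda(\alpha_t(A)))$ along the same net. Then for all $A,B\in\mathcal A$: (i) every net $\Lambda\uparrow\Delta$ has a subnet along which $\pi_\varphi(m_\Lambda(A))$ converges in the weak-operator topology; (ii) every density $\widehat A_\infty$ lies in the center of the von Neumann algebra $\pi_\varphi(\mathcal A)''$, and for every $t\in\mathbb R$ the limit $\widehat A_\infty(t)$ along the same net exists and equals $\widehat A_\infty$; (iii) for all densities $\widehat A_\infty(\cdot)$ of $A$ and $\widehat B_\infty$ of $B$ (possibly along different nets), the temporal correlation function $$f^{\varphi}_{A,B}(t)=\bigl\langle\Omega_\varphi,\ \widehat A_\infty(t)\,\widehat B_\infty\,\Omega_\varphi\bigr\rangle$$ satisfies $f^\varphi_{A,B}(t)=f^\varphi_{A,B}(0)$ for all $t\in\mathbb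 R$. That is, there is no nontrivial temporal long-range order. -/

import Mathlib

open Filter Topology MeasureTheory
open scoped ComplexOrder Pointwise

/-- A quasi-local C⋆-system over the space `Γ`: the C⋆-algebra `A` of the infinite system with its
subsystems `localAlg S` (isotonous unital C⋆-subalgebras, commuting for disjoint regions, those of
bounded regions having dense union) and the covariant action `τ` of the space translations. -/
structure QuasiLocalSystem (Γ A : Type*) [AddCommGroup Γ] [TopologicalSpace Γ]
    [CStarAlgebra A] where
  /-- the algebra of the subsystem in a region -/
  localAlg : Set Γ → StarSubalgebra ℂ A
  isClosed_localAlg : ∀ S, IsClosed (localAlg S : Set A)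
  mono : ∀ S T, S ⊆ T → localAlg S ≤ localAlg T
  /-- the local algebra is norm dense; a region is bounded if it is relatively compact, that is,
  finite when `Γ = ℤ^μ` -/
  dense_local : Dense (⋃ S ∈ {S : Set Γ | IsCompact (closure S)}, (localAlg S : Set A))
  local_commute : ∀ S T, Disjoint S T → ∀ a ∈ localAlg S, ∀ b ∈ localAlg T, a * b = b * a
  /-- the space-translation automorphisms -/
  τ : Γ → (A ≃⋆ₐ[ℂ] A)
  τ_zero : ∀ a, τ 0 a = a
  τ_add : ∀ x y a, τ (x + y) a = τ x (τ y a)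
  τ_localAlg : ∀ x S, τ x '' (localAlg S : Set A) = localAlg ((fun y => y + x) '' S)

/-- A C⋆-dynamics: a strongly continuous one-parameter group of automorphisms. -/
structure CStarDynamics (A : Type*) [CStarAlgebra A] where
  /-- the automorphism at time `t` -/
  α : ℝ → (A ≃⋆ₐ[ℂ] A)
  α_zero : ∀ a, α 0 a = a
  α_add : ∀ s t a, α (s + t) a = α s (α t a)
  tendsto_α : ∀ a, Tendsto (fun t => α t a) (𝓝 0) (𝓝 a)

/-- The subgroups of `Γ` with respect to which one speaks of homogeneity: infinite, closed and
cocompact. These are `Γ` itself and its crystallographic subgroups: in `ℤ^μ` exactly the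
subgroups of finite index, in `ℝ^μ` in particular the lattices. -/
structure IsCrystallographic {Γ : Type*} [AddCommGroup Γ] [TopologicalSpace Γ]
    (Δ : AddSubgroup Γ) : Prop where
  isClosed : IsClosed (Δ : Set Γ)
  cocompact : CompactSpace (Γ ⧸ Δ)
  infinite : ¬ IsCompact (Δ : Set Γ)

section Equilibrium

variable {A : Type*} [CStarAlgebra A] [PartialOrder A] [StarOrderedRing A]

/-- The KMS condition at finite inverse temperature `β`. -/
def IsKMS (D : CStarDynamics A) (β : ℝ) (φ : A →ₚ[ℂ] ℂ) : Prop :=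
  ∀ a b : A, ∃ F : ℂ → ℂ,
    ContinuousOn F {z | 0 ≤ z.im ∧ z.im ≤ β} ∧
    (∃ C : ℝ, ∀ z : ℂ, 0 ≤ z.im → z.im ≤ β → ‖F z‖ ≤ C) ∧
    DifferentiableOn ℂ F {z | 0 < z.im ∧ z.im < β} ∧
    ∀ t : ℝ, F t = φ (a * D.α t b) ∧ F (t + Complex.I * β) = φ (D.α t b * a)

/-- The KMS condition at `β = ∞`, defining ground states. -/
def IsGround (D : CStarDynamics A) (φ : A →ₚ[ℂ] ℂ) : Prop :=
  ∀ a b : A, ∃ F : ℂ → ℂ,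
    ContinuousOn F {z | 0 ≤ z.im} ∧
    (∃ C : ℝ, ∀ z : ℂ, 0 ≤ z.im → ‖F z‖ ≤ C) ∧
    DifferentiableOn ℂ F {z | 0 < z.im} ∧
    ∀ t : ℝ, F t = φ (a * D.α t b)

/-- Equilibrium states: states (normalized positive functionals) satisfying the KMS condition at
some positive or infinite inverse temperature. -/
def IsEquilibriumState (D : CStarDynamics A) (φ : A →ₚ[ℂ] ℂ) : Prop :=
  φ 1 = 1 ∧ ((∃ β : ℝ, 0 < β ∧ IsKMS D β φ) ∨ IsGround D φ)

end Equilibrium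

section GNS

variable {A : Type*} [CStarAlgebra A] [PartialOrder A] [StarOrderedRing A]

/-- The cyclic vector of the GNS representation `φ.gnsStarAlgHom` on `φ.GNS`. -/
noncomputable def gnsVector (φ : A →ₚ[ℂ] ℂ) : φ.GNS :=
  ((φ.toPreGNS 1 : φ.PreGNS) : UniformSpace.Completion φ.PreGNS)

theorem gnsStarAlgHom_gnsVector (φ : A →ₚ[ℂ] ℂ) (a : A) :
    φ.gnsStarAlgHom a (gnsVector φ) =
      ((φ.toPreGNS a : φ.PreGNS) : UniformSpace.Completion φ.PreGNS) := by
  simp [gnsVector]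

theorem inner_gnsVector (φ : A →ₚ[ℂ] ℂ) (a : A) :
    inner ℂ (gnsVector φ) (φ.gnsStarAlgHom a (gnsVector φ)) = φ a := by
  rw [gnsStarAlgHom_gnsVector, gnsVector, UniformSpace.Completion.inner_coe,
    PositiveLinearMap.preGNS_inner_def]
  simp

theorem denseRange_gnsVector (φ : A →ₚ[ℂ] ℂ) :
    DenseRange (fun a => φ.gnsStarAlgHom a (gnsVector φ)) := by
  simp only [gnsStarAlgHom_gnsVector]
  exact UniformSpace.Completion.denseRange_coe.comp φ.toPreGNS.surjective.denseRange
    (UniformSpace.Completion.continuous_coe _)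

/-- The von Neumann algebra `π_φ(A)''` generated by the GNS representation. -/
def gnsVonNeumann (φ : A →ₚ[ℂ] ℂ) : Set (φ.GNS →L[ℂ] φ.GNS) :=
  (Set.range φ.gnsStarAlgHom).centralizer.centralizer

/-- The center `𝔐_φ ∩ 𝔐_φ'` of the von Neumann algebra `𝔐_φ = π_φ(A)''`. -/
def gnsCenter (φ : A →ₚ[ℂ] ℂ) : Set (φ.GNS →L[ℂ] φ.GNS) :=
  gnsVonNeumann φ ∩ (gnsVonNeumann φ).centralizer

end GNS

section Densities

variable {Γ A : Type*} [AddCommGroup Γ] [TopologicalSpace Γ] [IsTopologicalAddGroup Γ]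
  [LocallyCompactSpace Γ] [T2Space Γ] [SecondCountableTopology Γ]
  [MeasurableSpace Γ] [BorelSpace Γ] [CStarAlgebra A]

/-- The dynamics is homogeneous in space: translation invariant (`Δ = ⊤`) or spatially
periodic. -/
def IsHomogeneousDynamics (Q : QuasiLocalSystem Γ A) (D : CStarDynamics A) : Prop :=
  ∃ Δ : AddSubgroup Γ, IsCrystallographic Δ ∧
    ∀ x ∈ Δ, ∀ t a, D.α t (Q.τ x a) = Q.τ x (D.α t a)

/-- The average `m_Λ(a) = |Λ|⁻¹ ∑_{x ∈ Λ} τ_x(a)` over a region `Λ` of finite volume in `Δ`. Sum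
and volume refer to a Haar measure `ν` of `Δ`, see `spaceMean_eq_sum` for discrete `Δ`. -/
noncomputable def spaceMean (Q : QuasiLocalSystem Γ A) {Δ : AddSubgroup Γ} (ν : Measure Δ)
    (Λ : Set Δ) (a : A) : A :=
  (ν.real Λ)⁻¹ • ∫ x in Λ, Q.τ (x : Γ) a ∂ν

theorem spaceMean_eq_sum {Γ A : Type*} [AddCommGroup Γ] [TopologicalSpace Γ]
    [IsTopologicalAddGroup Γ] [MeasurableSpace Γ] [BorelSpace Γ] [CStarAlgebra A]
    (Q : QuasiLocalSystem Γ A) {Δ : AddSubgroup Γ} [DiscreteTopology Δ] [Countable Δ]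
    (ν : Measure Δ) [ν.IsAddHaarMeasure] (Λ : Finset Δ) (a : A) :
    spaceMean Q ν (Λ : Set Δ) a = ((Λ.card : ℝ))⁻¹ • ∑ x ∈ Λ, Q.τ (x : Γ) a := by
  have h0 : ∀ x : Δ, ν.real {x} = ν.real {0} := fun x => by
    rw [Measure.real, Measure.real, Measure.addHaar_singleton]
  have hpos : ν.real ({0} : Set Δ) ≠ 0 := by
    have h1 : ν ({0} : Set Δ) ≠ 0 := ((isOpen_discrete ({0} : Set Δ)).measure_pos ν ⟨0, rfl⟩).ne'
    have h2 : ν ({0} : Set Δ) ≠ ⊤ := isCompact_singleton.measure_lt_top.ne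
    exact (ENNReal.toReal_pos h1 h2).ne'
  have hint : ∫ x in (Λ : Set Δ), Q.τ (x : Γ) a ∂ν
      = ν.real ({0} : Set Δ) • ∑ x ∈ Λ, Q.τ (x : Γ) a := by
    have hu : (Λ : Set Δ) = ⋃ x ∈ Λ, {x} := by ext; simp
    rw [hu, integral_biUnion_finset]
    · simp only [integral_singleton, h0, Finset.smul_sum]
    · exact fun x _ => measurableSet_singleton x
    · exact fun x _ y _ h => Set.disjoint_singleton.2 h
    · exact fun x _ => integrableOn_singleton (hx := isCompact_singleton.measure_lt_top)
  have hvol : ν.real (Λ : Set Δ) = Λ.card * ν.real ({0} : Set Δ) := by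
    rw [← sum_measureReal_singleton]
    simp [h0]
  rw [spaceMean, hint, hvol, smul_smul, mul_inv, mul_assoc, inv_mul_cancel₀ hpos, mul_one]

/-- `Λ ↑ Δ`: a net of regions of finite volume in `Δ` that eventually includes every bounded
region. A subnet is obtained by passing to a finer filter. -/
structure IsExhausting {Δ : AddSubgroup Γ} (ν : Measure Δ) {ι : Type*} (l : Filter ι)
    (Λ : ι → Set Δ) : Prop where
  measurableSet : ∀ i, MeasurableSet (Λ i)
  finite_volume : ∀ i, ν (Λ i) < ⊤
  eventually_subset : ∀ K : Set Δ, IsCompact K → ∀ᶠ i in l, K ⊆ Λ i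

variable [PartialOrder A] [StarOrderedRing A]

/-- `Z` is the macroscopic density of `a` along the net `Λ`: the limit of `π_φ(m_Λ(a))` in the
weak operator topology. The accumulation points of a net are the densities along its subnets. -/
def IsDensity (Q : QuasiLocalSystem Γ A) {Δ : AddSubgroup Γ} (ν : Measure Δ)
    (φ : A →ₚ[ℂ] ℂ) {ι : Type*} (l : Filter ι) (Λ : ι → Set Δ) (a : A)
    (Z : φ.GNS →L[ℂ] φ.GNS) : Prop :=
  Tendsto (fun i => (ContinuousLinearMapWOT.ofCLM
      (φ.gnsStarAlgHom (spaceMean Q ν (Λ i) a)) : φ.GNS →WOT[ℂ] φ.GNS)) l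
    (𝓝 (ContinuousLinearMapWOT.ofCLM Z))

end Densities

/-- The temporal correlation `f(t) = ⟪Ω, Â(t) B̂ Ω⟫`. -/
noncomputable def temporalCorrelation {A : Type*} [CStarAlgebra A] [PartialOrder A]
    [StarOrderedRing A] (φ : A →ₚ[ℂ] ℂ) (Ahat : ℝ → (φ.GNS →L[ℂ] φ.GNS))
    (Bhat : φ.GNS →L[ℂ] φ.GNS) (t : ℝ) : ℂ :=
  inner ℂ (gnsVector φ) ((Ahat t * Bhat) (gnsVector φ))

/-! The mechanism is that averaging over large regions makes observables central, and a central
element is invisible to an equilibrium dynamics. Locality makes the commutator of `τ x a` with a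
fixed `b` small for `x` off a compact set. The volume of the regions tends to infinity, so the means
are asymptotically central and their weak limits `Z` are central. For central `Z`, Mazur's lemma
gives `c n` in the algebra with `π(c n)Ω → ZΩ` and `π((c n)⋆)Ω → Z⋆Ω` in norm. By Phragmén–Lindelöf
the KMS functions of the pairs `(c n, b)` converge uniformly, and centrality makes the two boundary
values of the limit agree. The limit then extends periodically to a bounded entire function, which
is constant by Liouville. For ground states Schwarz reflection replaces periodicity. Hence `φ (d i *
α t b) - φ (d i * b) → 0` for every bounded asymptotically central ultrafilter net `d`
(`IsEquilibriumState.tendsto_asymptoticallyCentral`). To conclude (`IsDensity.eq_of_ultrafilter`),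
let `c i` be the difference of the means of `α t a` and `a`, with weak limit `W - Z`. The functional
`ψ d = ⟪(W - Z)Ω, π(d)Ω⟫` is the limit of `φ (star (c j) * d)`. Invariance of `φ` moves a
translation of `d` onto `star (c j)`, which stays asymptotically central, so `ψ` takes equal values
on `τ x (α t a)` and `τ x a`. Averaging over `x` gives `ψ (c i) = 0`, and the limit in `i` gives `(W
- Z)Ω = 0`. As `Ω` is cyclic and `W - Z` commutes with the algebra, `W = Z`. -/

/-! ### Complex analysis: Morera, Liouville, Phragmén–Lindelöf -/

/-- A continuous function that is holomorphic off equidistant horizontal lines is entire. -/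
theorem differentiable_of_differentiableAt_off_horizontal_lines {f : ℂ → ℂ} {β : ℝ} (hβ : 0 < β)
    (hf : Continuous f)
    (hd : ∀ (n : ℤ) (z : ℂ), n * β < z.im → z.im < (n + 1) * β → DifferentiableAt ℂ f z) :
    Differentiable ℂ f := by
  have hcr : ∀ y : ℝ, Continuous fun x : ℝ => f (x + y * Complex.I) := fun y => by fun_prop
  have hci : ∀ x : ℝ, Continuous fun y : ℝ => f (x + y * Complex.I) := fun x => by fun_prop
  have hcons : Complex.IsConservativeOn f Set.univ := by
    intro z w _
    rw [← add_eq_zero_iff_eq_neg, Complex.wedgeIntegral_add_wedgeIntegral_eq]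
    -- Boundary integral of the rectangle between heights `p` and `q`. It is additive in the
    -- heights, so cutting along the exceptional lines reduces its vanishing to rectangles inside
    -- one strip, where Cauchy's theorem needs only continuity on the edges.
    set J : ℝ → ℝ → ℂ := fun p q =>
      (∫ x : ℝ in z.re..w.re, f (x + p * Complex.I)) -
      (∫ x : ℝ in z.re..w.re, f (x + q * Complex.I)) +
      Complex.I • (∫ y : ℝ in p..q, f (w.re + y * Complex.I)) -
      Complex.I • (∫ y : ℝ in p..q, f (z.re + y * Complex.I)) with hJ
    have hadd : ∀ p q r, J p q + J q r = J p r := by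
      intro p q r
      simp only [hJ]
      rw [← intervalIntegral.integral_add_adjacent_intervals
          ((hci w.re).intervalIntegrable p q) ((hci w.re).intervalIntegrable q r),
        ← intervalIntegral.integral_add_adjacent_intervals
          ((hci z.re).intervalIntegrable p q) ((hci z.re).intervalIntegrable q r)]
      simp only [smul_eq_mul]
      ring
    have hstrip : ∀ (n : ℤ) (p q : ℝ), n * β ≤ p → p ≤ q → q ≤ (n + 1) * β → J p q = 0 := by
      intro n p q hp hpq hq
      have := Complex.integral_boundary_rect_eq_zero_of_continuousOn_of_differentiableOn f
        (z.re + p * Complex.I) (w.re + q * Complex.I) hf.continuousOn (by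
          intro x hx
          rw [Complex.mem_reProdIm] at hx
          have h2 := hx.2
          simp [min_eq_left hpq, max_eq_right hpq] at h2
          exact (hd n x (hp.trans_lt h2.1) (h2.2.trans_le hq)).differentiableWithinAt)
      simpa [hJ] using this
    have hline : ∀ n : ℤ, J 0 (n * β) = 0 := by
      intro n
      induction n using Int.induction_on with
      | zero => simpa using hstrip 0 0 0 (by simp) le_rfl (by simp [hβ.le])
      | succ n ih =>
        have := hstrip n (n * β) ((n + 1) * β) (by simp) (by nlinarith) (by simp)
        have h2 := hadd 0 (n * β) ((n + 1) * β)
        push_cast at ih ⊢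
        rw [← h2, this, ih, add_zero]
      | pred n ih =>
        have := hstrip (-n - 1) ((-n - 1) * β) (-n * β) (by simp) (by nlinarith) (by simp)
        have h2 := hadd 0 ((-n - 1) * β) (-n * β)
        push_cast at ih ⊢
        rw [ih, this, add_zero] at h2
        exact h2
    have hzero : ∀ q, J 0 q = 0 := by
      intro q
      rw [← hadd 0 (⌊q / β⌋ * β) q, hline, zero_add]
      refine hstrip ⌊q / β⌋ _ _ le_rfl ?_ ?_
      · exact (le_div_iff₀ hβ).1 (Int.floor_le _)
      · exact ((div_lt_iff₀ hβ).1 (Int.lt_floor_add_one _)).le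
    have := hadd 0 z.im w.im
    rw [hzero, hzero, zero_add] at this
    exact this
  -- Morera: `f` has an entire primitive, and derivatives of entire functions are entire.
  obtain ⟨g, hg⟩ := hcons.isExactOn_univ hf
  have hgd : Differentiable ℂ g := fun z => (hg z trivial).differentiableAt
  have : deriv g = f := funext fun z => (hg z trivial).deriv
  rw [← this]
  exact hgd.deriv

theorem locallyFinite_Icc_int_mul {β : ℝ} (hβ : 0 < β) :
    LocallyFinite fun n : ℤ => Set.Icc (n * β) ((n + 1) * β) := by
  intro x
  refine ⟨Set.Ioo (x - β) (x + β), Ioo_mem_nhds (by linarith) (by linarith),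
    (Set.finite_Icc (⌊x / β⌋ - 2) (⌊x / β⌋ + 2)).subset ?_⟩
  rintro n ⟨y, ⟨h1, h2⟩, h3, h4⟩
  have h5 : (⌊x / β⌋ : ℝ) * β ≤ x := (le_div_iff₀ hβ).1 (Int.floor_le _)
  have h6 : x < (⌊x / β⌋ + 1) * β := (div_lt_iff₀ hβ).1 (Int.lt_floor_add_one _)
  constructor
  · have : ((⌊x / β⌋ : ℤ) : ℝ) - 2 < n := lt_of_mul_lt_mul_right (by linarith) hβ.le
    exact_mod_cast this.le
  · have : (n : ℝ) < ⌊x / β⌋ + 2 := lt_of_mul_lt_mul_right (by linarith) hβ.le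
    exact_mod_cast this.le

/-- A bounded holomorphic function on a strip with equal boundary values on both edges is
constant. -/
theorem eq_of_strip_of_boundary_eq {G : ℂ → ℂ} {β C : ℝ} (hβ : 0 < β)
    (hc : ContinuousOn G {z | 0 ≤ z.im ∧ z.im ≤ β})
    (hC : ∀ z : ℂ, 0 ≤ z.im → z.im ≤ β → ‖G z‖ ≤ C)
    (hd : DifferentiableOn ℂ G {z | 0 < z.im ∧ z.im < β})
    (hb : ∀ t : ℝ, G (t + Complex.I * β) = G t) (s t : ℝ) : G s = G t := by
  -- The extension of `G` with period `iβ`.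
  set f : ℂ → ℂ := fun z => G (z - ⌊z.im / β⌋ * β * Complex.I) with hf
  have him : ∀ (n : ℤ) (z : ℂ), (z - n * β * Complex.I).im = z.im - n * β := by
    intro n z
    simp
  have heq : ∀ (n : ℤ) (z : ℂ), n * β ≤ z.im → z.im ≤ (n + 1) * β →
      f z = G (z - n * β * Complex.I) := by
    intro n z h1 h2
    rcases h2.lt_or_eq with h2 | h2
    · have : ⌊z.im / β⌋ = n :=
        Int.floor_eq_iff.2 ⟨(le_div_iff₀ hβ).2 h1, (div_lt_iff₀ hβ).2 h2⟩
      simp only [hf, this]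
    -- On the top edge the floor already belongs to the next strip; the boundary hypothesis
    -- reconciles the two formulas.
    · have : ⌊z.im / β⌋ = n + 1 := by
        rw [h2, mul_div_cancel_right₀ _ hβ.ne']
        exact_mod_cast Int.floor_intCast (n + 1)
      simp only [hf, this]
      have e1 : z - ((n + 1 : ℤ) : ℂ) * β * Complex.I = (z.re : ℂ) := by
        apply Complex.ext <;> simp [h2]
      have e2 : z - n * β * Complex.I = z.re + Complex.I * β := by
        apply Complex.ext <;> simp [h2]
        ring
      rw [e1, e2, hb]
  have hcf : Continuous f := by
    refine ((locallyFinite_Icc_int_mul hβ).preimage_continuous Complex.continuous_im).continuous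
      ?_ (fun n => isClosed_Icc.preimage Complex.continuous_im) ?_
    · refine Set.eq_univ_of_forall fun z => Set.mem_iUnion.2 ⟨⌊z.im / β⌋, ?_⟩
      exact ⟨(le_div_iff₀ hβ).1 (Int.floor_le _),
        ((div_lt_iff₀ hβ).1 (Int.lt_floor_add_one _)).le⟩
    · intro n
      refine ContinuousOn.congr (f := fun z => G (z - n * β * Complex.I)) ?_
        fun z hz => heq n z hz.1 hz.2
      refine hc.comp (by fun_prop) fun z hz => ?_
      have h1 := hz.1
      have h2 := hz.2
      exact ⟨by rw [him]; linarith, by rw [him]; linarith⟩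
  have hfd : Differentiable ℂ f := by
    refine differentiable_of_differentiableAt_off_horizontal_lines hβ hcf fun n z h1 h2 => ?_
    have hev : f =ᶠ[𝓝 z] fun z => G (z - n * β * Complex.I) := by
      filter_upwards [(isOpen_Ioo.preimage Complex.continuous_im).mem_nhds ⟨h1, h2⟩] with w hw
      exact heq n w hw.1.le hw.2.le
    refine DifferentiableAt.congr_of_eventuallyEq ?_ hev
    have hopen : IsOpen {z : ℂ | 0 < z.im ∧ z.im < β} := isOpen_Ioo.preimage Complex.continuous_im
    have : DifferentiableAt ℂ G (z - n * β * Complex.I) :=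
      hd.differentiableAt (hopen.mem_nhds ⟨by rw [him]; linarith, by rw [him]; linarith⟩)
    exact this.comp z (by fun_prop)
  have hbd : Bornology.IsBounded (Set.range f) := by
    refine isBounded_iff_forall_norm_le.2 ⟨C, ?_⟩
    rintro _ ⟨z, rfl⟩
    have h5 := (le_div_iff₀ hβ).1 (Int.floor_le (z.im / β))
    have h6 := (div_lt_iff₀ hβ).1 (Int.lt_floor_add_one (z.im / β))
    exact hC _ (by rw [him]; linarith) (by rw [him]; linarith)
  have := hfd.apply_eq_apply_of_bounded hbd s t
  simpa [hf] using this

/-- Bounded holomorphic functions on the two half planes with equal boundary values are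
constant. -/
theorem eq_of_halfPlane_of_boundary_conj {G G' : ℂ → ℂ} {C C' : ℝ}
    (hc : ContinuousOn G {z | 0 ≤ z.im}) (hc' : ContinuousOn G' {z | 0 ≤ z.im})
    (hC : ∀ z : ℂ, 0 ≤ z.im → ‖G z‖ ≤ C) (hC' : ∀ z : ℂ, 0 ≤ z.im → ‖G' z‖ ≤ C')
    (hd : DifferentiableOn ℂ G {z | 0 < z.im}) (hd' : DifferentiableOn ℂ G' {z | 0 < z.im})
    (hb : ∀ t : ℝ, G' t = starRingEnd ℂ (G t)) (s t : ℝ) : G s = G t := by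
  -- Schwarz reflection, with `G'` supplying the values below the real axis.
  set f : ℂ → ℂ := fun z =>
    if 0 ≤ z.im then G z else starRingEnd ℂ (G' (starRingEnd ℂ z)) with hf
  have hopen : IsOpen {z : ℂ | 0 < z.im} := isOpen_Ioi.preimage Complex.continuous_im
  have hopen' : IsOpen {z : ℂ | z.im < 0} := isOpen_Iio.preimage Complex.continuous_im
  have hcf : Continuous f := by
    refine continuous_if_le continuous_const Complex.continuous_im hc ?_ ?_
    · refine Complex.continuous_conj.comp_continuousOn
        (hc'.comp Complex.continuous_conj.continuousOn fun z hz => ?_)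
      simpa using hz
    · intro z hz
      have : z = (z.re : ℂ) := Complex.ext rfl hz.symm
      rw [this, Complex.conj_ofReal, hb, Complex.conj_conj]
  have hfd : Differentiable ℂ f := by
    -- The spacing 1 is arbitrary: it only matters that the real axis is one of the lines.
    refine differentiable_of_differentiableAt_off_horizontal_lines one_pos hcf
      fun n z h1 h2 => ?_
    simp only [mul_one] at h1 h2
    rcases lt_or_ge n 0 with hn | hn
    · have hz : z.im < 0 := by
        have : ((n + 1 : ℤ) : ℝ) ≤ 0 := by exact_mod_cast hn
        push_cast at this
        linarith
      have hev : f =ᶠ[𝓝 z] fun z => starRingEnd ℂ (G' (starRingEnd ℂ z)) := by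
        filter_upwards [hopen'.mem_nhds hz] with w hw
        exact if_neg (not_le.2 hw)
      refine DifferentiableAt.congr_of_eventuallyEq ?_ hev
      have h3 : DifferentiableAt ℂ G' (starRingEnd ℂ z) :=
        hd'.differentiableAt (hopen.mem_nhds (by simpa using hz))
      simpa [Function.comp_def] using h3.conj_conj
    · have hz : 0 < z.im := by
        have : (0 : ℝ) ≤ n := by exact_mod_cast hn
        linarith
      have hev : f =ᶠ[𝓝 z] G := by
        filter_upwards [hopen.mem_nhds hz] with w hw
        exact if_pos (le_of_lt hw)
      exact (hd.differentiableAt (hopen.mem_nhds hz)).congr_of_eventuallyEq hev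
  have hbd : Bornology.IsBounded (Set.range f) := by
    refine isBounded_iff_forall_norm_le.2 ⟨max C C', ?_⟩
    rintro _ ⟨z, rfl⟩
    by_cases hz : 0 ≤ z.im
    · simp only [hf, if_pos hz]
      exact (hC z hz).trans (le_max_left _ _)
    · simp only [hf, if_neg hz, RCLike.norm_conj]
      exact (hC' _ (by simpa using (not_le.1 hz).le)).trans (le_max_right _ _)
  have := hfd.apply_eq_apply_of_bounded hbd s t
  simpa [hf] using this

/-- Phragmén–Lindelöf: a priori boundedness, by whatever constant, suffices for the maximum
principle. Applied to differences of KMS functions, it turns edge estimates into uniform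
convergence. -/
theorem norm_le_of_strip_of_boundary {F : ℂ → ℂ} {β C : ℝ} (hβ : 0 < β)
    (hc : ContinuousOn F {z | 0 ≤ z.im ∧ z.im ≤ β})
    (hB : ∃ B : ℝ, ∀ z : ℂ, 0 ≤ z.im → z.im ≤ β → ‖F z‖ ≤ B)
    (hd : DifferentiableOn ℂ F {z | 0 < z.im ∧ z.im < β})
    (h0 : ∀ t : ℝ, ‖F t‖ ≤ C) (h1 : ∀ t : ℝ, ‖F (t + Complex.I * β)‖ ≤ C)
    {z : ℂ} (hz : 0 ≤ z.im ∧ z.im ≤ β) : ‖F z‖ ≤ C := by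
  obtain ⟨B, hB⟩ := hB
  refine PhragmenLindelof.horizontal_strip (a := 0) (b := β) ⟨hd, ?_⟩
    ⟨0, by simpa using div_pos Real.pi_pos hβ, 0, ?_⟩ ?_ ?_ hz.1 hz.2
  · rw [Complex.closure_preimage_im, closure_Ioo hβ.ne]
    exact hc
  · refine Asymptotics.IsBigO.of_bound B ?_
    filter_upwards [mem_inf_of_right (mem_principal_self _)] with w hw
    simpa using hB w hw.1.le hw.2.le
  · intro w hw
    have : w = (w.re : ℂ) := Complex.ext rfl hw
    rw [this]
    exact h0 _
  · intro w hw
    have : w = w.re + Complex.I * β := by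
      apply Complex.ext <;> simp [hw]
    rw [this]
    exact h1 _

theorem norm_le_of_halfPlane_of_boundary {F : ℂ → ℂ} {C : ℝ}
    (hc : ContinuousOn F {z | 0 ≤ z.im})
    (hB : ∃ B : ℝ, ∀ z : ℂ, 0 ≤ z.im → ‖F z‖ ≤ B)
    (hd : DifferentiableOn ℂ F {z | 0 < z.im})
    (h0 : ∀ t : ℝ, ‖F t‖ ≤ C) {z : ℂ} (hz : 0 ≤ z.im) : ‖F z‖ ≤ C := by
  obtain ⟨B, hB⟩ := hB
  -- Multiplication by `i` carries the right half plane onto the upper one.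
  have key := PhragmenLindelof.right_half_plane_of_bounded_on_real
    (f := fun w => F (Complex.I * w)) (z := -Complex.I * z) (C := C) ⟨?_, ?_⟩ ⟨0, two_pos, 0, ?_⟩ ?_
    ?_ (by simpa using hz)
  · simpa [← mul_assoc] using key
  · exact hd.comp (by fun_prop) fun w hw => by simpa using hw
  · rw [Complex.closure_setOfPred_lt_re]
    exact hc.comp (by fun_prop) fun w hw => by simpa using hw
  · refine Asymptotics.IsBigO.of_bound B ?_
    filter_upwards [mem_inf_of_right (mem_principal_self _)] with w hw
    simpa using hB (Complex.I * w) (by simpa using le_of_lt hw)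
  · refine ⟨B, ?_⟩
    rw [eventually_map]
    filter_upwards [eventually_ge_atTop 0] with x hx
    exact hB _ (by simpa using hx)
  · intro x
    have : Complex.I * (x * Complex.I) = ((-x : ℝ) : ℂ) := by
      push_cast
      linear_combination (x : ℂ) * Complex.I_sq
    simpa only [this] using h0 (-x)

/-- The uniform limit of a uniformly Cauchy sequence of bounded functions that are continuous on
`S` and holomorphic on the open subset `U`. -/
theorem exists_limit_of_uniformCauchy {S U : Set ℂ} (hU : IsOpen U) (hUS : U ⊆ S)
    {F : ℕ → ℂ → ℂ} (hc : ∀ n, ContinuousOn (F n) S)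
    (hB : ∀ n, ∃ B : ℝ, ∀ z ∈ S, ‖F n z‖ ≤ B) (hd : ∀ n, DifferentiableOn ℂ (F n) U)
    (hF : UniformCauchySeqOn F atTop S) :
    ∃ G : ℂ → ℂ, ContinuousOn G S ∧ (∃ B : ℝ, ∀ z ∈ S, ‖G z‖ ≤ B) ∧ DifferentiableOn ℂ G U ∧
      ∀ z ∈ S, Tendsto (fun n => F n z) atTop (𝓝 (G z)) := by
  have hlim : ∀ z, ∃ w, z ∈ S → Tendsto (fun n => F n z) atTop (𝓝 w) := fun z => by
    by_cases hz : z ∈ S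
    · obtain ⟨w, hw⟩ := cauchySeq_tendsto_of_complete (hF.cauchySeq hz)
      exact ⟨w, fun _ => hw⟩
    · exact ⟨0, fun h => absurd h hz⟩
  choose G hG using hlim
  have hunif : TendstoUniformlyOn F G atTop S :=
    hF.tendstoUniformlyOn_of_tendsto fun z hz => hG z hz
  refine ⟨G, hunif.continuousOn (Frequently.of_forall hc), ?_, ?_, fun z => hG z⟩
  · obtain ⟨n, hn⟩ := (Metric.tendstoUniformlyOn_iff.1 hunif 1 one_pos).exists
    obtain ⟨B, hB⟩ := hB n
    refine ⟨1 + B, fun z hz => ?_⟩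
    calc ‖G z‖ = ‖(G z - F n z) + F n z‖ := by rw [sub_add_cancel]
      _ ≤ ‖G z - F n z‖ + ‖F n z‖ := norm_add_le _ _
      _ ≤ 1 + B := add_le_add (by simpa [dist_eq_norm] using (hn z hz).le) (hB z hz)
  · exact (hunif.mono hUS).tendstoLocallyUniformlyOn.differentiableOn
      (Eventually.of_forall hd) hU

/-! ### Weak operator compactness and Mazur's lemma -/

section WeakLimits

variable {H : Type*} [NormedAddCommGroup H] [InnerProductSpace ℂ H] [CompleteSpace H]

/-- Bounded sets of operators are relatively compact in the weak operator topology. -/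
theorem exists_tendsto_wot_of_bounded {ι : Type*} (u : Ultrafilter ι) (T : ι → H →L[ℂ] H) {C : ℝ}
    (hC : ∀ i, ‖T i‖ ≤ C) :
    ∃ Z : H →L[ℂ] H, Tendsto (fun i => (ContinuousLinearMapWOT.ofCLM (T i) : H →WOT[ℂ] H)) u
      (𝓝 (ContinuousLinearMapWOT.ofCLM Z)) := by
  have hbd : ∀ x y i, ‖inner ℂ (T i x) y‖ ≤ C * ‖x‖ * ‖y‖ := fun x y i =>
    (norm_inner_le_norm _ _).trans (by
      gcongr
      exact (T i).le_of_opNorm_le (hC i) x)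
  have hlim : ∀ x y, ∃ w : ℂ, ‖w‖ ≤ C * ‖x‖ * ‖y‖ ∧
      Tendsto (fun i => inner ℂ (T i x) y) u (𝓝 w) := by
    intro x y
    obtain ⟨w, hw, hw'⟩ := (isCompact_closedBall (0 : ℂ) (C * ‖x‖ * ‖y‖)).ultrafilter_le_nhds
      (u.map fun i => inner ℂ (T i x) y) (by
        rw [Ultrafilter.coe_map, le_principal_iff, mem_map]
        exact univ_mem' fun i => by simpa using hbd x y i)
    exact ⟨w, by simpa using hw, hw'⟩
  choose B hB hBlim using hlim
  -- The ultrafilter limits of the matrix elements form a bounded sesquilinear form; Riesz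
  -- representation turns it into the operator `Z`.
  let L : H →ₗ⋆[ℂ] H →ₗ[ℂ] ℂ := LinearMap.mk₂'ₛₗ (starRingEnd ℂ) (RingHom.id ℂ) B
    (fun x x' y => tendsto_nhds_unique (hBlim (x + x') y)
      (((hBlim x y).add (hBlim x' y)).congr fun i => by simp))
    (fun c x y => tendsto_nhds_unique (hBlim (c • x) y)
      (((hBlim x y).const_mul (starRingEnd ℂ c)).congr fun i => by simp [mul_comm]))
    (fun x y y' => tendsto_nhds_unique (hBlim x (y + y'))
      (((hBlim x y).add (hBlim x y')).congr fun i => by simp))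
    (fun c x y => tendsto_nhds_unique (hBlim x (c • y))
      (((hBlim x y).const_mul c).congr fun i => by simp))
  refine ⟨InnerProductSpace.continuousLinearMapOfBilin (L.mkContinuous₂ C hB), ?_⟩
  rw [ContinuousLinearMapWOT.tendsto_iff_forall_inner_apply_tendsto]
  intro x y
  have h1 := (Complex.continuous_conj.tendsto _).comp (hBlim x y)
  have h2 : B x y =
      inner ℂ (InnerProductSpace.continuousLinearMapOfBilin (L.mkContinuous₂ C hB) x) y := by
    rw [InnerProductSpace.continuousLinearMapOfBilin_apply]
    rfl
  rw [h2, inner_conj_symm] at h1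
  exact h1.congr fun i => inner_conj_symm _ _

/-- Mazur's lemma in a product of two Hilbert spaces. -/
theorem mem_closure_of_tendsto_inner {ι : Type*} {l : Filter ι} [l.NeBot] {s : Set (H × H)}
    (hs : Convex ℝ s) {p : ι → H × H} (hp : ∀ i, p i ∈ s) {q : H × H}
    (h1 : ∀ x, Tendsto (fun i => inner ℂ x (p i).1) l (𝓝 (inner ℂ x q.1)))
    (h2 : ∀ x, Tendsto (fun i => inner ℂ x (p i).2) l (𝓝 (inner ℂ x q.2))) :
    q ∈ closure s := by
  by_contra hq
  obtain ⟨f, r, hf, hr⟩ := RCLike.geometric_hahn_banach_closed_point (𝕜 := ℂ) hs.closure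
    isClosed_closure hq
  set x := (InnerProductSpace.toDual ℂ H).symm (f.comp (ContinuousLinearMap.inl ℂ H H))
  set y := (InnerProductSpace.toDual ℂ H).symm (f.comp (ContinuousLinearMap.inr ℂ H H))
  have hsplit : ∀ v : H × H, f v = inner ℂ x v.1 + inner ℂ y v.2 := by
    intro v
    simp only [x, y, InnerProductSpace.toDual_symm_apply, ContinuousLinearMap.comp_apply,
      ContinuousLinearMap.inl_apply, ContinuousLinearMap.inr_apply, ← map_add]
    simp
  have ht : Tendsto (fun i => f (p i)) l (𝓝 (f q)) := by
    simp only [hsplit]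
    exact (h1 x).add (h2 y)
  have ht' := (RCLike.continuous_re.tendsto _).comp ht
  exact absurd (le_of_tendsto ht' (Eventually.of_forall fun i =>
    (hf _ (subset_closure (hp i))).le)) (not_le.2 hr)

end WeakLimits

/-! ### Equilibrium conditions against central elements -/

section States

variable {A : Type*} [CStarAlgebra A] [PartialOrder A] [StarOrderedRing A]

theorem inner_gnsStarAlgHom_left (φ : A →ₚ[ℂ] ℂ) (a : A) (x y : φ.GNS) :
    inner ℂ (φ.gnsStarAlgHom (star a) x) y = inner ℂ x (φ.gnsStarAlgHom a y) := by
  rw [map_star, ContinuousLinearMap.star_eq_adjoint, ContinuousLinearMap.adjoint_inner_left]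

theorem gnsStarAlgHom_mul_apply (φ : A →ₚ[ℂ] ℂ) (a b : A) (x : φ.GNS) :
    φ.gnsStarAlgHom (a * b) x = φ.gnsStarAlgHom a (φ.gnsStarAlgHom b x) := by
  rw [map_mul]
  rfl

theorem gnsStarAlgHom_real_smul_apply (φ : A →ₚ[ℂ] ℂ) (r : ℝ) (a : A) (x : φ.GNS) :
    φ.gnsStarAlgHom (r • a) x = r • φ.gnsStarAlgHom a x := by
  rw [← Complex.coe_smul, map_smul, smul_apply, Complex.coe_smul]

theorem inner_gnsStarAlgHom_gnsVector (φ : A →ₚ[ℂ] ℂ) (a b : A) :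
    inner ℂ (φ.gnsStarAlgHom a (gnsVector φ)) (φ.gnsStarAlgHom b (gnsVector φ)) =
      φ (star a * b) := by
  rw [← inner_gnsVector φ (star a * b), gnsStarAlgHom_mul_apply,
    ← inner_gnsStarAlgHom_left φ (star a), star_star]

theorem norm_gnsStarAlgHom_apply_le (φ : A →ₚ[ℂ] ℂ) (a : A) (x : φ.GNS) :
    ‖φ.gnsStarAlgHom a x‖ ≤ ‖a‖ * ‖x‖ :=
  (φ.gnsStarAlgHom a).le_of_opNorm_le (NonUnitalStarAlgHom.norm_apply_le _ _) x

theorem CStarDynamics.norm_α (D : CStarDynamics A) (t : ℝ) (a : A) : ‖D.α t a‖ = ‖a‖ :=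
  StarAlgEquiv.norm_map _ _

theorem uniformCauchySeqOn_of_norm_sub_le {E : Type*} [NormedAddCommGroup E] {S : Set ℂ}
    {F : ℕ → ℂ → ℂ} {ζ : ℕ → E} (hζ : CauchySeq ζ) {K : ℝ} (hK : 0 ≤ K)
    (h : ∀ m n, ∀ z ∈ S, ‖F m z - F n z‖ ≤ ‖ζ m - ζ n‖ * K) :
    UniformCauchySeqOn F atTop S := by
  rw [Metric.uniformCauchySeqOn_iff]
  intro ε hε
  obtain ⟨N, hN⟩ := Metric.cauchySeq_iff.1 hζ (ε / (K + 1)) (by positivity)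
  refine ⟨N, fun m hm n hn z hz => ?_⟩
  rw [dist_eq_norm]
  have h1 := hN m hm n hn
  rw [dist_eq_norm] at h1
  calc ‖F m z - F n z‖ ≤ ‖ζ m - ζ n‖ * K := h m n z hz
    _ ≤ ε / (K + 1) * K := by gcongr
    _ < ε / (K + 1) * (K + 1) := by gcongr; linarith
    _ = ε := by field_simp

/-- The functional `d ↦ ⟪η, π_φ(d) Ω⟫` is a limit of functionals `d ↦ φ (c n * d)` that extend to
the strip; when it also equals `d ↦ ⟪Ω, π_φ(d) ξ⟫` the KMS condition at finite `β` makes it time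
invariant. -/
theorem IsKMS.inner_α_eq {D : CStarDynamics A} {β : ℝ} (hβ : 0 < β) {φ : A →ₚ[ℂ] ℂ}
    (hφ : IsKMS D β φ) {c : ℕ → A} {ξ η : φ.GNS}
    (hξ : Tendsto (fun n => φ.gnsStarAlgHom (c n) (gnsVector φ)) atTop (𝓝 ξ))
    (hη : Tendsto (fun n => φ.gnsStarAlgHom (star (c n)) (gnsVector φ)) atTop (𝓝 η))
    (hc : ∀ d, inner ℂ η (φ.gnsStarAlgHom d (gnsVector φ)) =
      inner ℂ (gnsVector φ) (φ.gnsStarAlgHom d ξ)) (b : A) (t : ℝ) :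
    inner ℂ η (φ.gnsStarAlgHom (D.α t b) (gnsVector φ)) =
      inner ℂ η (φ.gnsStarAlgHom b (gnsVector φ)) := by
  have hl : ∀ n d, φ (c n * d) =
      inner ℂ (φ.gnsStarAlgHom (star (c n)) (gnsVector φ)) (φ.gnsStarAlgHom d (gnsVector φ)) :=
    fun n d => by rw [inner_gnsStarAlgHom_gnsVector, star_star]
  have hr : ∀ n d, φ (d * c n) =
      inner ℂ (φ.gnsStarAlgHom (star d) (gnsVector φ)) (φ.gnsStarAlgHom (c n) (gnsVector φ)) :=
    fun n d => by rw [inner_gnsStarAlgHom_gnsVector, star_star]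
  choose F hFc hFB hFd hF using fun n => hφ (c n) b
  -- The pair controls both edges: the lower one through `star (c n)`, the upper one through `c n`.
  have hζ := (hξ.prodMk_nhds hη).cauchySeq
  set ζ : ℕ → φ.GNS × φ.GNS := fun n =>
    (φ.gnsStarAlgHom (c n) (gnsVector φ), φ.gnsStarAlgHom (star (c n)) (gnsVector φ))
  set K := ‖b‖ * ‖gnsVector φ‖
  have hcau : UniformCauchySeqOn F atTop {z : ℂ | 0 ≤ z.im ∧ z.im ≤ β} := by
    refine uniformCauchySeqOn_of_norm_sub_le hζ (K := K) (by positivity) fun m n z hz => ?_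
    refine norm_le_of_strip_of_boundary (F := fun z => F m z - F n z) hβ ((hFc m).sub (hFc n)) ?_
      ((hFd m).sub (hFd n)) (fun s => ?_) (fun s => ?_) hz
    · obtain ⟨B, hB⟩ := hFB m
      obtain ⟨B', hB'⟩ := hFB n
      exact ⟨B + B', fun w h0 h1 => (norm_sub_le _ _).trans (add_le_add (hB w h0 h1) (hB' w h0 h1))⟩
    · rw [(hF m s).1, (hF n s).1, hl, hl, ← inner_sub_left]
      refine (norm_inner_le_norm _ _).trans ?_
      gcongr
      · exact norm_snd_le (ζ m - ζ n)
      · exact (norm_gnsStarAlgHom_apply_le _ _ _).trans_eq (by rw [D.norm_α])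
    · rw [(hF m s).2, (hF n s).2, hr, hr, ← inner_sub_right]
      refine (norm_inner_le_norm _ _).trans ?_
      rw [mul_comm]
      gcongr
      · exact norm_fst_le (ζ m - ζ n)
      · exact (norm_gnsStarAlgHom_apply_le _ _ _).trans_eq (by rw [norm_star, D.norm_α])
  obtain ⟨G, hGc, ⟨B, hB⟩, hGd, hG⟩ := exists_limit_of_uniformCauchy
    (U := {z : ℂ | 0 < z.im ∧ z.im < β}) (isOpen_Ioo.preimage Complex.continuous_im)
    (S := {z : ℂ | 0 ≤ z.im ∧ z.im ≤ β}) (fun z hz => ⟨hz.1.le, hz.2.le⟩)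
    hFc (fun n => (hFB n).imp fun B hB z hz => hB z hz.1 hz.2)
    hFd hcau
  have hG0 : ∀ s : ℝ, G s = inner ℂ η (φ.gnsStarAlgHom (D.α s b) (gnsVector φ)) := fun s => by
    refine tendsto_nhds_unique (hG s (by simp [hβ.le])) ?_
    simp only [(hF _ s).1, hl]
    exact hη.inner tendsto_const_nhds
  -- The upper edge converges to `⟪Ω, π(α s b) ξ⟫`, which `hc` identifies with the lower edge.
  have hG1 : ∀ s : ℝ, G (s + Complex.I * β) = G s := fun s => by
    rw [hG0, hc, ← inner_gnsStarAlgHom_left]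
    refine tendsto_nhds_unique (hG _ (by simp [hβ.le])) ?_
    simp only [(hF _ s).2, hr]
    exact tendsto_const_nhds.inner hξ
  have := eq_of_strip_of_boundary_eq hβ hGc (fun z h0 h1 => hB z ⟨h0, h1⟩) hGd hG1 t 0
  rwa [hG0, hG0, D.α_zero] at this

theorem IsGround.exists_limit {D : CStarDynamics A} {φ : A →ₚ[ℂ] ℂ} (hφ : IsGround D φ)
    {c : ℕ → A} {η : φ.GNS}
    (hη : Tendsto (fun n => φ.gnsStarAlgHom (star (c n)) (gnsVector φ)) atTop (𝓝 η)) (b : A) :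
    ∃ G : ℂ → ℂ, ContinuousOn G {z | 0 ≤ z.im} ∧ (∃ B : ℝ, ∀ z : ℂ, 0 ≤ z.im → ‖G z‖ ≤ B) ∧
      DifferentiableOn ℂ G {z | 0 < z.im} ∧
      ∀ s : ℝ, G s = inner ℂ η (φ.gnsStarAlgHom (D.α s b) (gnsVector φ)) := by
  have hl : ∀ n d, φ (c n * d) =
      inner ℂ (φ.gnsStarAlgHom (star (c n)) (gnsVector φ)) (φ.gnsStarAlgHom d (gnsVector φ)) :=
    fun n d => by rw [inner_gnsStarAlgHom_gnsVector, star_star]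
  choose F hFc hFB hFd hF using fun n => hφ (c n) b
  have hcau : UniformCauchySeqOn F atTop {z : ℂ | 0 ≤ z.im} := by
    refine uniformCauchySeqOn_of_norm_sub_le hη.cauchySeq (K := ‖b‖ * ‖gnsVector φ‖)
      (by positivity) fun m n z hz => ?_
    refine norm_le_of_halfPlane_of_boundary (F := fun z => F m z - F n z) ((hFc m).sub (hFc n)) ?_
      ((hFd m).sub (hFd n)) (fun s => ?_) hz
    · obtain ⟨B, hB⟩ := hFB m
      obtain ⟨B', hB'⟩ := hFB n
      exact ⟨B + B', fun w h0 => (norm_sub_le _ _).trans (add_le_add (hB w h0) (hB' w h0))⟩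
    · rw [hF m s, hF n s, hl, hl, ← inner_sub_left]
      refine (norm_inner_le_norm _ _).trans ?_
      gcongr
      exact (norm_gnsStarAlgHom_apply_le _ _ _).trans_eq (by rw [D.norm_α])
  obtain ⟨G, hGc, hB, hGd, hG⟩ := exists_limit_of_uniformCauchy
    (U := {z : ℂ | 0 < z.im}) (isOpen_Ioi.preimage Complex.continuous_im)
    (S := {z : ℂ | 0 ≤ z.im}) (fun z (hz : 0 < z.im) => hz.le) hFc
    (fun n => (hFB n).imp fun B hB z hz => hB z hz) hFd hcau
  refine ⟨G, hGc, hB, hGd, fun s => tendsto_nhds_unique (hG s (by simp)) ?_⟩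
  simp only [hF _ s, hl]
  exact hη.inner tendsto_const_nhds

/-- With no upper edge available, the second function comes from the pair `(star (c n), star b)`;
`hc` makes its boundary values the conjugates of those of the first. -/
theorem IsGround.inner_α_eq {D : CStarDynamics A} {φ : A →ₚ[ℂ] ℂ}
    (hφ : IsGround D φ) {c : ℕ → A} {ξ η : φ.GNS}
    (hξ : Tendsto (fun n => φ.gnsStarAlgHom (c n) (gnsVector φ)) atTop (𝓝 ξ))
    (hη : Tendsto (fun n => φ.gnsStarAlgHom (star (c n)) (gnsVector φ)) atTop (𝓝 η))
    (hc : ∀ d, inner ℂ η (φ.gnsStarAlgHom d (gnsVector φ)) =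
      inner ℂ (gnsVector φ) (φ.gnsStarAlgHom d ξ)) (b : A) (t : ℝ) :
    inner ℂ η (φ.gnsStarAlgHom (D.α t b) (gnsVector φ)) =
      inner ℂ η (φ.gnsStarAlgHom b (gnsVector φ)) := by
  obtain ⟨G, hGc, ⟨C, hC⟩, hGd, hG⟩ := hφ.exists_limit hη b
  obtain ⟨G', hGc', ⟨C', hC'⟩, hGd', hG'⟩ :=
    hφ.exists_limit (c := fun n => star (c n)) (by simpa using hξ) (star b)
  have := eq_of_halfPlane_of_boundary_conj hGc hGc' hC hC' hGd hGd' (fun s => by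
    rw [hG, hG', hc, map_star, ← inner_gnsStarAlgHom_left, inner_conj_symm,
      star_star]) t 0
  rwa [hG, hG, D.α_zero] at this

/-- Equilibrium states are time invariant even after multiplication by elements of the center of
`π_φ(A)''` that are approximable in the strong⋆ topology at the cyclic vector. -/
theorem IsEquilibriumState.inner_α_eq {D : CStarDynamics A} {φ : A →ₚ[ℂ] ℂ}
    (hφ : IsEquilibriumState D φ) {c : ℕ → A} {ξ η : φ.GNS}
    (hξ : Tendsto (fun n => φ.gnsStarAlgHom (c n) (gnsVector φ)) atTop (𝓝 ξ))
    (hη : Tendsto (fun n => φ.gnsStarAlgHom (star (c n)) (gnsVector φ)) atTop (𝓝 η))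
    (hc : ∀ d, inner ℂ η (φ.gnsStarAlgHom d (gnsVector φ)) =
      inner ℂ (gnsVector φ) (φ.gnsStarAlgHom d ξ)) (b : A) (t : ℝ) :
    inner ℂ η (φ.gnsStarAlgHom (D.α t b) (gnsVector φ)) =
      inner ℂ η (φ.gnsStarAlgHom b (gnsVector φ)) := by
  obtain ⟨-, ⟨β, hβ, h⟩ | h⟩ := hφ
  · exact h.inner_α_eq hβ hξ hη hc b t
  · exact h.inner_α_eq hξ hη hc b t

end States

/-! ### Asymptotically central nets -/

section AsymptoticallyCentral

variable {A : Type*} [CStarAlgebra A]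

/-- A net in `A` is asymptotically central if its commutator with each element tends to zero. -/
def IsAsymptoticallyCentral {ι : Type*} (l : Filter ι)
    (d : ι → A) : Prop :=
  ∀ b, Tendsto (fun i => d i * b - b * d i) l (𝓝 0)

theorem IsAsymptoticallyCentral.star {ι : Type*} {l : Filter ι} {d : ι → A}
    (h : IsAsymptoticallyCentral l d) : IsAsymptoticallyCentral l fun i => star (d i) := by
  intro b
  have h1 := ((h (Star.star b)).star).neg
  simpa using h1

theorem IsAsymptoticallyCentral.map_starAlgEquiv {ι : Type*} {l : Filter ι} {d : ι → A}
    (h : IsAsymptoticallyCentral l d) (e : A ≃⋆ₐ[ℂ] A) :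
    IsAsymptoticallyCentral l fun i => e (d i) := by
  intro b
  have h1 := h (e.symm b)
  rw [tendsto_zero_iff_norm_tendsto_zero] at h1 ⊢
  refine h1.congr fun i => ?_
  rw [← StarAlgEquiv.norm_map e]
  simp

theorem IsAsymptoticallyCentral.sub {ι : Type*} {l : Filter ι} {d d' : ι → A}
    (h : IsAsymptoticallyCentral l d) (h' : IsAsymptoticallyCentral l d') :
    IsAsymptoticallyCentral l fun i => d i - d' i := by
  intro b
  have h1 := (h b).sub (h' b)
  rw [sub_zero] at h1
  exact h1.congr fun i => by noncomm_ring

variable [PartialOrder A] [StarOrderedRing A]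

/-- The weak limit of the representatives of an asymptotically central net commutes with the
represented algebra. -/
theorem IsAsymptoticallyCentral.mul_comm_of_tendsto {φ : A →ₚ[ℂ] ℂ} {ι : Type*} {l : Filter ι}
    [l.NeBot] {d : ι → A} (hd : IsAsymptoticallyCentral l d) {Z : φ.GNS →L[ℂ] φ.GNS}
    (hZ : Tendsto (fun i => (ContinuousLinearMapWOT.ofCLM (φ.gnsStarAlgHom (d i)) :
      φ.GNS →WOT[ℂ] φ.GNS)) l (𝓝 (ContinuousLinearMapWOT.ofCLM Z))) (b : A) :
    Z * φ.gnsStarAlgHom b = φ.gnsStarAlgHom b * Z := by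
  rw [ContinuousLinearMapWOT.tendsto_iff_forall_inner_apply_tendsto] at hZ
  ext x
  refine ext_inner_left ℂ fun y => ?_
  have h1 := hZ (φ.gnsStarAlgHom b x) y
  have h2 := hZ x (φ.gnsStarAlgHom (Star.star b) y)
  have h3 : Tendsto (fun i => inner ℂ y (φ.gnsStarAlgHom (d i * b - b * d i) x)) l (𝓝 0) := by
    refine squeeze_zero_norm (a := fun i => ‖y‖ * (‖d i * b - b * d i‖ * ‖x‖)) (fun i => ?_) ?_
    · refine (norm_inner_le_norm _ _).trans ?_
      gcongr
      exact norm_gnsStarAlgHom_apply_le _ _ _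
    · simpa using ((hd b).norm.mul_const ‖x‖).const_mul ‖y‖
  have h4 := h1.sub h2
  have h5 := tendsto_nhds_unique h3 (h4.congr fun i => by
    rw [inner_gnsStarAlgHom_left, ← inner_sub_right, map_sub, sub_apply,
      gnsStarAlgHom_mul_apply, gnsStarAlgHom_mul_apply]
    rfl)
  simp only [ContinuousLinearMapWOT.ofCLM_apply, inner_gnsStarAlgHom_left] at h5
  exact (sub_eq_zero.1 h5.symm)

/-- In an equilibrium state, bounded asymptotically central nets do not see the dynamics. -/
theorem IsEquilibriumState.tendsto_asymptoticallyCentral {D : CStarDynamics A} {φ : A →ₚ[ℂ] ℂ}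
    (hφ : IsEquilibriumState D φ) {ι : Type*} (u : Ultrafilter ι) {d : ι → A} {C : ℝ}
    (hC : ∀ i, ‖d i‖ ≤ C) (hd : IsAsymptoticallyCentral u d) (b : A) (t : ℝ) :
    Tendsto (fun i => φ (d i * D.α t b) - φ (d i * b)) u (𝓝 0) := by
  obtain ⟨Z, hZ⟩ := exists_tendsto_wot_of_bounded u (fun i => φ.gnsStarAlgHom (d i))
    (fun i => (NonUnitalStarAlgHom.norm_apply_le _ _).trans (hC i))
  have hcomm := hd.mul_comm_of_tendsto hZ
  rw [ContinuousLinearMapWOT.tendsto_iff_forall_inner_apply_tendsto] at hZ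
  set Ω := gnsVector φ
  set p : A → φ.GNS × φ.GNS := fun c => (φ.gnsStarAlgHom c Ω, φ.gnsStarAlgHom (star c) Ω)
  have hconv : Convex ℝ (Set.range p) := by
    -- Only real combinations are used, since the second component is conjugate linear in `c`.
    rintro _ ⟨c, rfl⟩ _ ⟨c', rfl⟩ r s _ _ _
    refine ⟨r • c + s • c', ?_⟩
    simp only [p, star_add, star_smul, star_trivial, map_add, add_apply,
      gnsStarAlgHom_real_smul_apply, Prod.smul_mk, Prod.mk_add_mk]
  have hmem : (Z Ω, ContinuousLinearMap.adjoint Z Ω) ∈ closure (Set.range p) := by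
    refine mem_closure_of_tendsto_inner (l := (u : Filter ι)) hconv (p := fun i => p (d i))
      (fun i => ⟨_, rfl⟩) (fun x => hZ Ω x) fun x => ?_
    have h1 := (Complex.continuous_conj.tendsto _).comp (hZ x Ω)
    rw [inner_conj_symm, ContinuousLinearMapWOT.ofCLM_apply,
      ← ContinuousLinearMap.adjoint_inner_right] at h1
    refine h1.congr fun i => ?_
    simp only [Function.comp_apply, inner_conj_symm, p]
    rw [← inner_gnsStarAlgHom_left, star_star]
    rfl
  obtain ⟨q, hq, hqlim⟩ := mem_closure_iff_seq_limit.1 hmem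
  choose c hcq using hq
  have hξ : Tendsto (fun n => φ.gnsStarAlgHom (c n) Ω) atTop (𝓝 (Z Ω)) := by
    exact ((continuous_fst.tendsto _).comp hqlim).congr fun n => by rw [Function.comp_apply, ← hcq]
  have hη : Tendsto (fun n => φ.gnsStarAlgHom (star (c n)) Ω) atTop
      (𝓝 (ContinuousLinearMap.adjoint Z Ω)) := by
    exact ((continuous_snd.tendsto _).comp hqlim).congr fun n => by rw [Function.comp_apply, ← hcq]
  have hinv := hφ.inner_α_eq hξ hη (fun e => by
    rw [ContinuousLinearMap.adjoint_inner_left]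
    congr 1
    exact congrArg (fun T : φ.GNS →L[ℂ] φ.GNS => T Ω) (hcomm e)) b t
  rw [ContinuousLinearMap.adjoint_inner_left, ContinuousLinearMap.adjoint_inner_left] at hinv
  have hlim : ∀ e, Tendsto (fun i => φ (d i * e)) u
      (𝓝 (inner ℂ Ω (Z (φ.gnsStarAlgHom e Ω)))) := fun e => by
    refine (hZ (φ.gnsStarAlgHom e Ω) Ω).congr fun i => ?_
    rw [← inner_gnsVector, map_mul]
    rfl
  have := (hlim (D.α t b)).sub (hlim b)
  rwa [hinv, sub_self] at this

end AsymptoticallyCentral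

/-! ### Locality and decay of commutators -/

section Commutators

variable {Γ A : Type*} [AddCommGroup Γ] [TopologicalSpace Γ] [CStarAlgebra A]

theorem QuasiLocalSystem.norm_τ (Q : QuasiLocalSystem Γ A) (x : Γ) (a : A) : ‖Q.τ x a‖ = ‖a‖ :=
  StarAlgEquiv.norm_map _ _

theorem QuasiLocalSystem.exists_local_dist_lt (Q : QuasiLocalSystem Γ A) (a : A) {ε : ℝ}
    (hε : 0 < ε) : ∃ S : Set Γ, IsCompact (closure S) ∧ ∃ a' ∈ Q.localAlg S, ‖a - a'‖ < ε := by
  obtain ⟨a', ha', h⟩ := Q.dense_local.exists_dist_lt a hε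
  simp only [Set.mem_iUnion] at ha'
  obtain ⟨S, hS, ha'⟩ := ha'
  exact ⟨S, hS, a', ha', by rwa [dist_eq_norm] at h⟩

/-- Observables commute asymptotically under large space translations. -/
theorem QuasiLocalSystem.exists_compact_norm_commutator_le [IsTopologicalAddGroup Γ]
    (Q : QuasiLocalSystem Γ A) (a b : A) {ε : ℝ} (hε : 0 < ε) :
    ∃ K : Set Γ, IsCompact K ∧ ∀ x ∉ K, ‖Q.τ x a * b - b * Q.τ x a‖ ≤ ε := by
  obtain ⟨T, hT, b', hb', hbb⟩ := Q.exists_local_dist_lt b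
    (show 0 < ε / (4 * (‖a‖ + 1)) by positivity)
  obtain ⟨S, hS, a', ha', haa⟩ := Q.exists_local_dist_lt a
    (show 0 < ε / (4 * (‖b'‖ + 1)) by positivity)
  -- `S + x` meets `T` only if `x ∈ T - S`.
  refine ⟨closure T + -closure S, hT.add hS.neg, fun x hx => ?_⟩
  have hdisj : Disjoint ((fun y => y + x) '' S) T := by
    rw [Set.disjoint_left]
    rintro _ ⟨y, hy, rfl⟩ hyT
    exact hx ⟨y + x, subset_closure hyT, -y, Set.neg_mem_neg.2 (subset_closure hy), by simp⟩
  have hloc : Q.τ x a' ∈ Q.localAlg ((fun y => y + x) '' S) := by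
    have : Q.τ x a' ∈ Q.τ x '' (Q.localAlg S : Set A) := ⟨a', ha', rfl⟩
    rwa [Q.τ_localAlg] at this
  have hcomm := Q.local_commute _ _ hdisj _ hloc _ hb'
  have hsplit : Q.τ x a * b - b * Q.τ x a = Q.τ x (a - a') * b' - b' * Q.τ x (a - a')
      + (Q.τ x a * (b - b') - (b - b') * Q.τ x a) := by
    rw [map_sub, sub_mul (Q.τ x a), mul_sub b', hcomm]
    noncomm_ring
  have h1 : ‖Q.τ x (a - a') * b'‖ ≤ ε / 4 := by
    calc ‖Q.τ x (a - a') * b'‖ ≤ ‖a - a'‖ * ‖b'‖ := by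
          rw [← Q.norm_τ x (a - a')]; exact norm_mul_le _ _
      _ ≤ ε / (4 * (‖b'‖ + 1)) * (‖b'‖ + 1) := by gcongr; linarith
      _ = ε / 4 := by field_simp
  have h2 : ‖b' * Q.τ x (a - a')‖ ≤ ε / 4 := by
    calc ‖b' * Q.τ x (a - a')‖ ≤ ‖b'‖ * ‖a - a'‖ := by
          rw [← Q.norm_τ x (a - a')]; exact norm_mul_le _ _
      _ ≤ (‖b'‖ + 1) * (ε / (4 * (‖b'‖ + 1))) := by gcongr; linarith
      _ = ε / 4 := by field_simp
  have h3 : ‖Q.τ x a * (b - b')‖ ≤ ε / 4 := by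
    calc ‖Q.τ x a * (b - b')‖ ≤ ‖a‖ * ‖b - b'‖ := by
          rw [← Q.norm_τ x a]; exact norm_mul_le _ _
      _ ≤ (‖a‖ + 1) * (ε / (4 * (‖a‖ + 1))) := by gcongr; linarith
      _ = ε / 4 := by field_simp
  have h4 : ‖(b - b') * Q.τ x a‖ ≤ ε / 4 := by
    calc ‖(b - b') * Q.τ x a‖ ≤ ‖b - b'‖ * ‖a‖ := by
          rw [← Q.norm_τ x a]; exact norm_mul_le _ _
      _ ≤ ε / (4 * (‖a‖ + 1)) * (‖a‖ + 1) := by gcongr; linarith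
      _ = ε / 4 := by field_simp
  rw [hsplit]
  refine (norm_add_le _ _).trans ?_
  have h5 := norm_sub_le (Q.τ x (a - a') * b') (b' * Q.τ x (a - a'))
  have h6 := norm_sub_le (Q.τ x a * (b - b')) ((b - b') * Q.τ x a)
  linarith

end Commutators

/-! ### Averages over growing regions -/

section SpaceMeans

variable {Γ A : Type*} [AddCommGroup Γ] [TopologicalSpace Γ] [MeasurableSpace Γ]
  [CStarAlgebra A]

theorem norm_spaceMean_le (Q : QuasiLocalSystem Γ A) {Δ : AddSubgroup Γ} (ν : Measure Δ)
    {Λ : Set Δ} (hΛ : ν Λ < ⊤) (a : A) : ‖spaceMean Q ν Λ a‖ ≤ ‖a‖ := by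
  rw [spaceMean, norm_smul, norm_inv, Real.norm_of_nonneg measureReal_nonneg]
  calc (ν.real Λ)⁻¹ * ‖∫ x in Λ, Q.τ (x : Γ) a ∂ν‖ ≤ (ν.real Λ)⁻¹ * (‖a‖ * ν.real Λ) := by
        gcongr
        exact norm_setIntegral_le_of_norm_le_const hΛ fun x _ => (Q.norm_τ x a).le
    _ = (ν.real Λ)⁻¹ * ν.real Λ * ‖a‖ := by ring
    -- An inequality rather than an equality, because the inverse is 0 on regions of volume zero.
    _ ≤ 1 * ‖a‖ := by
        gcongr
        exact inv_mul_le_one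
    _ = ‖a‖ := one_mul _

variable [SecondCountableTopology Γ] [BorelSpace Γ]

theorem integrableOn_τ (Q : QuasiLocalSystem Γ A) {Δ : AddSubgroup Γ}
    (hτ : ∀ a, Continuous (fun x : Δ => Q.τ (x : Γ) a)) (ν : Measure Δ) {Λ : Set Δ}
    (hΛ : ν Λ < ⊤) (a : A) : IntegrableOn (fun x : Δ => Q.τ (x : Γ) a) Λ ν := by
  have : SecondCountableTopology Δ := Topology.IsEmbedding.subtypeVal.secondCountableTopology
  exact IntegrableOn.of_bound hΛ (hτ a).aestronglyMeasurable ‖a‖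
    (Eventually.of_forall fun x => (Q.norm_τ x a).le)

theorem map_spaceMean (Q : QuasiLocalSystem Γ A) {Δ : AddSubgroup Γ}
    (hτ : ∀ a, Continuous (fun x : Δ => Q.τ (x : Γ) a)) (ν : Measure Δ) {Λ : Set Δ}
    (hΛ : ν Λ < ⊤) {E : Type*} [NormedAddCommGroup E] [NormedSpace ℝ E] [CompleteSpace E]
    (L : A →L[ℝ] E) (a : A) :
    L (spaceMean Q ν Λ a) = (ν.real Λ)⁻¹ • ∫ x in Λ, L (Q.τ (x : Γ) a) ∂ν := by
  rw [spaceMean, map_smul, ContinuousLinearMap.integral_comp_comm L (integrableOn_τ Q hτ ν hΛ a)]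

variable [IsTopologicalAddGroup Γ] [LocallyCompactSpace Γ] [T2Space Γ]

/-- The Haar measure of a noncompact group is infinite, so by inner regularity some compact set
exceeds any prescribed volume. -/
theorem IsExhausting.tendsto_inv_volume {Δ : AddSubgroup Γ} (hΔ : IsCrystallographic Δ)
    {ν : Measure Δ} [ν.IsAddHaarMeasure] {ι : Type*} {l : Filter ι} {Λ : ι → Set Δ}
    (hΛ : IsExhausting ν l Λ) : Tendsto (fun i => (ν.real (Λ i))⁻¹) l (𝓝 0) := by
  have : SecondCountableTopology Δ := Topology.IsEmbedding.subtypeVal.secondCountableTopology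
  have : LocallyCompactSpace Δ := hΔ.isClosed.isClosedEmbedding_subtypeVal.locallyCompactSpace
  have : NoncompactSpace Δ := by
    rw [← not_compactSpace_iff]
    exact fun h => hΔ.infinite (isCompact_iff_compactSpace.2 h)
  refine Filter.Tendsto.inv_tendsto_atTop (tendsto_atTop.2 fun r => ?_)
  obtain ⟨K, -, hK, hrK⟩ := (isOpen_univ (X := Δ)).exists_lt_isCompact (μ := ν)
    (r := ENNReal.ofReal r) (by
      rw [measure_univ_of_isAddLeftInvariant]
      exact ENNReal.ofReal_lt_top)
  filter_upwards [hΛ.eventually_subset K hK] with i hi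
  exact (ENNReal.ofReal_le_iff_le_toReal (hΛ.finite_volume i).ne).1
    (hrK.le.trans (measure_mono hi))

/-- The space means along an exhausting net are asymptotically central. -/
theorem IsExhausting.isAsymptoticallyCentral (Q : QuasiLocalSystem Γ A) {Δ : AddSubgroup Γ}
    (hΔ : IsCrystallographic Δ) (hτ : ∀ a, Continuous (fun x : Δ => Q.τ (x : Γ) a))
    {ν : Measure Δ} [ν.IsAddHaarMeasure] {ι : Type*} {l : Filter ι} {Λ : ι → Set Δ}
    (hΛ : IsExhausting ν l Λ) (a : A) :
    IsAsymptoticallyCentral l fun i => spaceMean Q ν (Λ i) a := by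
  intro b
  let L : A →L[ℝ] A := (ContinuousLinearMap.mul ℝ A).flip b - ContinuousLinearMap.mul ℝ A b
  have hL : ∀ c, L c = c * b - b * c := fun c => rfl
  rw [Metric.tendsto_nhds]
  intro ε hε
  obtain ⟨K, hK, hKε⟩ := Q.exists_compact_norm_commutator_le a b (half_pos hε)
  have hK' : IsCompact (Subtype.val ⁻¹' K : Set Δ) :=
    hΔ.isClosed.isClosedEmbedding_subtypeVal.isCompact_preimage hK
  set K' : Set Δ := Subtype.val ⁻¹' K
  -- The integral over `K'` is bounded independently of the region, so dividing by the volume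
  -- removes it; off `K'` the integrand is at most `ε / 2`.
  have hsmall := (hΛ.tendsto_inv_volume hΔ).mul_const (‖L‖ * ‖a‖ * ν.real K')
  rw [zero_mul] at hsmall
  filter_upwards [hsmall.eventually (gt_mem_nhds (half_pos hε))] with i hi
  have hfin := hΛ.finite_volume i
  have hint : IntegrableOn (fun x : Δ => L (Q.τ (x : Γ) a)) (Λ i) ν :=
    L.integrable_comp (integrableOn_τ Q hτ ν hfin a)
  rw [dist_zero_right, ← hL, map_spaceMean Q hτ ν hfin,
    ← integral_inter_add_sdiff hK'.measurableSet hint, norm_smul, norm_inv,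
    Real.norm_of_nonneg measureReal_nonneg]
  have h1 : ‖∫ x in Λ i ∩ K', L (Q.τ (x : Γ) a) ∂ν‖ ≤ ‖L‖ * ‖a‖ * ν.real K' := by
    refine (norm_setIntegral_le_of_norm_le_const
      ((measure_mono Set.inter_subset_left).trans_lt hfin) fun x _ => ?_).trans
      (mul_le_mul_of_nonneg_left (measureReal_mono Set.inter_subset_right
        hK'.measure_lt_top.ne) (by positivity))
    exact (L.le_opNorm _).trans_eq (by rw [Q.norm_τ])
  have h2 : ‖∫ x in Λ i \ K', L (Q.τ (x : Γ) a) ∂ν‖ ≤ ε / 2 * ν.real (Λ i) :=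
    (norm_setIntegral_le_of_norm_le_const
      ((measure_mono Set.sdiff_subset).trans_lt hfin) fun x hx => hKε x hx.2).trans
      (mul_le_mul_of_nonneg_left (measureReal_mono Set.sdiff_subset hfin.ne) (by positivity))
  calc (ν.real (Λ i))⁻¹ *
        ‖(∫ x in Λ i ∩ K', L (Q.τ (x : Γ) a) ∂ν) + ∫ x in Λ i \ K', L (Q.τ (x : Γ) a) ∂ν‖
      ≤ (ν.real (Λ i))⁻¹ * (‖L‖ * ‖a‖ * ν.real K' + ε / 2 * ν.real (Λ i)) := by
        gcongr
        exact (norm_add_le _ _).trans (add_le_add h1 h2)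
    _ = (ν.real (Λ i))⁻¹ * (‖L‖ * ‖a‖ * ν.real K') +
        (ν.real (Λ i))⁻¹ * ν.real (Λ i) * (ε / 2) := by ring
    _ ≤ (ν.real (Λ i))⁻¹ * (‖L‖ * ‖a‖ * ν.real K') + 1 * (ε / 2) := by
        gcongr
        exact inv_mul_le_one
    _ < ε := by linarith

end SpaceMeans

/-! ### Macroscopic densities -/

section Densities

variable {Γ A : Type*} [AddCommGroup Γ] [TopologicalSpace Γ] [MeasurableSpace Γ]
  [CStarAlgebra A] [PartialOrder A] [StarOrderedRing A]

theorem IsDensity.inner_tendsto {Q : QuasiLocalSystem Γ A} {Δ : AddSubgroup Γ} {ν : Measure Δ}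
    {φ : A →ₚ[ℂ] ℂ} {ι : Type*} {l : Filter ι} {Λ : ι → Set Δ} {a : A} {Z : φ.GNS →L[ℂ] φ.GNS}
    (hZ : IsDensity Q ν φ l Λ a Z) (x y : φ.GNS) :
    Tendsto (fun i => inner ℂ x (φ.gnsStarAlgHom (spaceMean Q ν (Λ i) a) y)) l
      (𝓝 (inner ℂ x (Z y))) :=
  ContinuousLinearMapWOT.tendsto_iff_forall_inner_apply_tendsto.1 hZ y x

theorem IsDensity.unique {Q : QuasiLocalSystem Γ A} {Δ : AddSubgroup Γ} {ν : Measure Δ}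
    {φ : A →ₚ[ℂ] ℂ} {ι : Type*} {l : Filter ι} [l.NeBot] {Λ : ι → Set Δ} {a : A}
    {Z Z' : φ.GNS →L[ℂ] φ.GNS} (hZ : IsDensity Q ν φ l Λ a Z) (hZ' : IsDensity Q ν φ l Λ a Z') :
    Z = Z' := by
  ext y
  exact ext_inner_left ℂ fun x => tendsto_nhds_unique (hZ.inner_tendsto x y) (hZ'.inner_tendsto x y)

theorem exists_isDensity_ultrafilter (Q : QuasiLocalSystem Γ A) {Δ : AddSubgroup Γ}
    (ν : Measure Δ) (φ : A →ₚ[ℂ] ℂ) {ι : Type*} (u : Ultrafilter ι) {Λ : ι → Set Δ}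
    (hΛ : ∀ i, ν (Λ i) < ⊤) (a : A) : ∃ Z, IsDensity Q ν φ u Λ a Z :=
  exists_tendsto_wot_of_bounded u _ fun i =>
    (NonUnitalStarAlgHom.norm_apply_le _ _).trans (norm_spaceMean_le Q ν (hΛ i) a)

variable [IsTopologicalAddGroup Γ] [LocallyCompactSpace Γ] [T2Space Γ]
  [SecondCountableTopology Γ] [BorelSpace Γ]

theorem IsDensity.mem_gnsCenter {Q : QuasiLocalSystem Γ A} {Δ : AddSubgroup Γ}
    (hΔ : IsCrystallographic Δ) (hτ : ∀ a, Continuous (fun x : Δ => Q.τ (x : Γ) a))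
    {ν : Measure Δ} [ν.IsAddHaarMeasure] {φ : A →ₚ[ℂ] ℂ} {ι : Type*} {l : Filter ι} [l.NeBot]
    {Λ : ι → Set Δ} (hΛ : IsExhausting ν l Λ) {a : A} {Z : φ.GNS →L[ℂ] φ.GNS}
    (hZ : IsDensity Q ν φ l Λ a Z) : Z ∈ gnsCenter φ := by
  have hcomm := (hΛ.isAsymptoticallyCentral Q hΔ hτ a).mul_comm_of_tendsto hZ
  constructor
  · intro T hT
    ext y
    refine ext_inner_left ℂ fun x => ?_
    have h1 := hZ.inner_tendsto (ContinuousLinearMap.adjoint T x) y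
    have h2 := hZ.inner_tendsto x (T y)
    refine (ContinuousLinearMap.adjoint_inner_left T _ _).symm.trans
      (tendsto_nhds_unique h1 (h2.congr fun i => ?_))
    rw [ContinuousLinearMap.adjoint_inner_left]
    exact congrArg (fun S : φ.GNS →L[ℂ] φ.GNS => inner ℂ x (S y)) (hT _ ⟨_, rfl⟩)
  · intro S hS
    refine (hS Z ?_).symm
    rintro _ ⟨b, rfl⟩
    exact (hcomm b).symm

/-- Along an ultrafilter the density of a time translate equals the density itself. -/
theorem IsDensity.eq_of_ultrafilter {Q : QuasiLocalSystem Γ A} {D : CStarDynamics A}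
    {Δ : AddSubgroup Γ} (hΔ : IsCrystallographic Δ)
    (hτ : ∀ a, Continuous (fun x : Δ => Q.τ (x : Γ) a)) {ν : Measure Δ} [ν.IsAddHaarMeasure]
    {φ : A →ₚ[ℂ] ℂ} (hφ : IsEquilibriumState D φ) (hφΔ : ∀ x ∈ Δ, ∀ a, φ (Q.τ x a) = φ a)
    {ι : Type*} {u : Ultrafilter ι} {Λ : ι → Set Δ} (hΛ : IsExhausting ν u Λ) {a : A} {t : ℝ}
    {Z W : φ.GNS →L[ℂ] φ.GNS} (hZ : IsDensity Q ν φ u Λ a Z)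
    (hW : IsDensity Q ν φ u Λ (D.α t a) W) : W = Z := by
  set Ω := gnsVector φ
  set c : ι → A := fun i => spaceMean Q ν (Λ i) (D.α t a) - spaceMean Q ν (Λ i) a with hc
  have hcen : IsAsymptoticallyCentral u c :=
    (hΛ.isAsymptoticallyCentral Q hΔ hτ _).sub (hΛ.isAsymptoticallyCentral Q hΔ hτ _)
  have hbd : ∀ i, ‖c i‖ ≤ ‖D.α t a‖ + ‖a‖ := fun i => (norm_sub_le _ _).trans
    (add_le_add (norm_spaceMean_le Q ν (hΛ.finite_volume i) _)
      (norm_spaceMean_le Q ν (hΛ.finite_volume i) _))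
  have hlim : ∀ x y : φ.GNS, Tendsto (fun i => inner ℂ x (φ.gnsStarAlgHom (c i) y)) u
      (𝓝 (inner ℂ x ((W - Z) y))) := fun x y => by
    have := (hW.inner_tendsto x y).sub (hZ.inner_tendsto x y)
    simp only [← inner_sub_right] at this
    refine this.congr fun i => ?_
    rw [hc, map_sub]
    rfl
  have hψlim : ∀ d, Tendsto (fun j => φ (star (c j) * d)) u
      (𝓝 (inner ℂ ((W - Z) Ω) (φ.gnsStarAlgHom d Ω))) := fun d => by
    have := (Complex.continuous_conj.tendsto _).comp (hlim (φ.gnsStarAlgHom d Ω) Ω)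
    rw [inner_conj_symm] at this
    refine this.congr fun j => ?_
    rw [Function.comp_apply, inner_conj_symm, inner_gnsStarAlgHom_gnsVector]
  have hinv : ∀ x : Δ, inner ℂ ((W - Z) Ω) (φ.gnsStarAlgHom (Q.τ (x : Γ) (D.α t a)) Ω) =
      inner ℂ ((W - Z) Ω) (φ.gnsStarAlgHom (Q.τ (x : Γ) a) Ω) := by
    intro x
    -- Here the invariance of `φ` moves the translation from the observable to the central net.
    have htr : ∀ j d, φ (star (c j) * Q.τ (x : Γ) d) = φ (Q.τ (-x : Γ) (star (c j)) * d) := by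
      intro j d
      rw [← hφΔ _ x.2 (Q.τ (-x : Γ) (star (c j)) * d), map_mul (Q.τ (x : Γ)),
        ← Q.τ_add, add_neg_cancel, Q.τ_zero]
    have h1 := hφ.tendsto_asymptoticallyCentral u (d := fun j => Q.τ (-x : Γ) (star (c j)))
      (fun j => by rw [Q.norm_τ, norm_star]; exact hbd j) (hcen.star.map_starAlgEquiv _) a t
    have h2 := (hψlim (Q.τ (x : Γ) (D.α t a))).sub (hψlim (Q.τ (x : Γ) a))
    simp only [htr] at h2
    exact sub_eq_zero.1 (tendsto_nhds_unique h2 h1)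
  let ψ : A →L[ℝ] ℂ := (LinearMap.mkContinuous
    { toFun := fun d => inner ℂ ((W - Z) Ω) (φ.gnsStarAlgHom d Ω)
      map_add' := fun d e => by rw [map_add, add_apply, inner_add_right]
      map_smul' := fun r d => by
        rw [map_smul, smul_apply, inner_smul_right]
        rfl }
    (‖(W - Z) Ω‖ * ‖Ω‖) (fun d => (norm_inner_le_norm ((W - Z) Ω) (φ.gnsStarAlgHom d Ω)).trans (by
      rw [mul_assoc, mul_comm ‖Ω‖]
      gcongr
      exact norm_gnsStarAlgHom_apply_le _ _ _)) : A →L[ℂ] ℂ).restrictScalars ℝ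
  have hψ : ∀ d, ψ d = inner ℂ ((W - Z) Ω) (φ.gnsStarAlgHom d Ω) := fun d => rfl
  have hzero : ∀ i, inner ℂ ((W - Z) Ω) (φ.gnsStarAlgHom (c i) Ω) = 0 := fun i => by
    rw [← hψ, hc, map_sub, map_spaceMean Q hτ ν (hΛ.finite_volume i),
      map_spaceMean Q hτ ν (hΛ.finite_volume i)]
    simp only [hψ, hinv, sub_self]
  -- The vanishing inner products with `π(c i)Ω` converge to `‖(W - Z)Ω‖²`.
  have hΩ : (W - Z) Ω = 0 := by
    have := hlim ((W - Z) Ω) Ω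
    simp only [hzero] at this
    exact inner_self_eq_zero.1 (tendsto_nhds_unique tendsto_const_nhds this).symm
  have hcomm : ∀ b, (W - Z) * φ.gnsStarAlgHom b = φ.gnsStarAlgHom b * (W - Z) := fun b =>
    hcen.mul_comm_of_tendsto (ContinuousLinearMapWOT.tendsto_iff_forall_inner_apply_tendsto.2
      fun y x => hlim x y) b
  refine sub_eq_zero.1 (DFunLike.coe_injective ?_)
  refine (denseRange_gnsVector φ).equalizer (W - Z).continuous continuous_const (funext fun b => ?_)
  refine (congrArg (fun T : φ.GNS →L[ℂ] φ.GNS => T Ω) (hcomm b)).trans ?_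
  change φ.gnsStarAlgHom b ((W - Z) Ω) = 0
  rw [hΩ, map_zero]

/-- Convergence along `l` is convergence along every finer ultrafilter; there compactness provides
some limit, and it must be `Z`. -/
theorem IsDensity.α {Q : QuasiLocalSystem Γ A} {D : CStarDynamics A}
    {Δ : AddSubgroup Γ} (hΔ : IsCrystallographic Δ)
    (hτ : ∀ a, Continuous (fun x : Δ => Q.τ (x : Γ) a)) {ν : Measure Δ} [ν.IsAddHaarMeasure]
    {φ : A →ₚ[ℂ] ℂ} (hφ : IsEquilibriumState D φ) (hφΔ : ∀ x ∈ Δ, ∀ a, φ (Q.τ x a) = φ a)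
    {ι : Type*} {l : Filter ι} {Λ : ι → Set Δ} (hΛ : IsExhausting ν l Λ) {a : A}
    {Z : φ.GNS →L[ℂ] φ.GNS} (hZ : IsDensity Q ν φ l Λ a Z) (t : ℝ) :
    IsDensity Q ν φ l Λ (D.α t a) Z := by
  refine (tendsto_iff_ultrafilter _ _ _).2 fun u hu => ?_
  have hΛu : IsExhausting ν u Λ :=
    ⟨hΛ.measurableSet, hΛ.finite_volume, fun K hK => hu (hΛ.eventually_subset K hK)⟩
  obtain ⟨W, hW⟩ := exists_isDensity_ultrafilter Q ν φ u hΛ.finite_volume (D.α t a)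
  rw [← IsDensity.eq_of_ultrafilter hΔ hτ hφ hφΔ hΛu (hZ.mono_left hu) hW]
  exact hW

end Densities

theorem mainTheorem3 {Γ A : Type*}
    [AddCommGroup Γ] [TopologicalSpace Γ] [IsTopologicalAddGroup Γ] [LocallyCompactSpace Γ]
    [T2Space Γ] [SecondCountableTopology Γ] [MeasurableSpace Γ] [BorelSpace Γ]
    [CStarAlgebra A] [PartialOrder A] [StarOrderedRing A]
    (Q : QuasiLocalSystem Γ A) (D : CStarDynamics A) (hD : IsHomogeneousDynamics Q D)
    (Δ : AddSubgroup Γ) (hΔ : IsCrystallographic Δ)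
    (hτ : ∀ a, Continuous (fun x : Δ => Q.τ (x : Γ) a))
    (ν : Measure Δ) [ν.IsAddHaarMeasure]
    (φ : A →ₚ[ℂ] ℂ) (hφ : IsEquilibriumState D φ) (hφΔ : ∀ x ∈ Δ, ∀ a, φ (Q.τ x a) = φ a)
    {ι κ : Type*} (l : Filter ι) [l.NeBot] (Λ : ι → Set Δ) (hΛ : IsExhausting ν l Λ)
    (k : Filter κ) [k.NeBot] (M : κ → Set Δ) (hM : IsExhausting ν k M) (a b : A) :
    (∃ l₁ ≤ l, l₁.NeBot ∧ ∃ Z, IsDensity Q ν φ l₁ Λ a Z) ∧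
    (∀ Z, IsDensity Q ν φ l Λ a Z →
      Z ∈ gnsCenter φ ∧ ∀ t, IsDensity Q ν φ l Λ (D.α t a) Z) ∧
    (∀ (Ahat : ℝ → (φ.GNS →L[ℂ] φ.GNS)) (Bhat : φ.GNS →L[ℂ] φ.GNS),
      (∀ t, IsDensity Q ν φ l Λ (D.α t a) (Ahat t)) → IsDensity Q ν φ k M b Bhat →
      ∀ t, temporalCorrelation φ Ahat Bhat t = temporalCorrelation φ Ahat Bhat 0) := by
  refine ⟨⟨Ultrafilter.of l, Ultrafilter.of_le l, inferInstance,
    exists_isDensity_ultrafilter Q ν φ _ hΛ.finite_volume a⟩,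
    fun Z hZ => ⟨hZ.mem_gnsCenter hΔ hτ hΛ, hZ.α hΔ hτ hφ hφΔ hΛ⟩, fun Ahat Bhat hA _ t => ?_⟩
  have h0 : IsDensity Q ν φ l Λ a (Ahat 0) := by simpa only [D.α_zero] using hA 0
  rw [temporalCorrelation, temporalCorrelation, (hA t).unique (h0.α hΔ hτ hφ hφΔ hΛ t)]
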